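/- Fix integers $1\le r\le K$. For $n$ divisible by $K$, let $\mathcal G=([n],\mathcal E)$ be an Erdős–Rényi graph $\mathrm{ER}(n,p)$, $p=p_n\in(0,1]$: each unordered pair of vertices is an edge with probability $p$, independently of the others (the statement holds both if self-loops $\{i,i\}$ are among these pairs and if they are excluded). For every ordered pair $(i,j)$ with $\{i,j\}\in\mathcal E$ there is an intermediate value $v_{i,j}\in\{0,1\}^T$, where $T=T_n\ge 1$. An allocation of computation load $r$ to $K$ machines is $A=(\mathcal M,\mathcal R)$, where $\mathcal M_1,\dots,\mathcal M_K\subseteq[n]$ cover $[n]$ with $|\mathcal M_k|=rn/K$ for all $k$, and $\mathcal R_1,\dots,\mathcal R_K$ partition $[n]$ with $|\mathcal R_k|=n/K$ for all $k$; let $\mathcal A(r)$ be the set of these allocations. Given $A$ and a realization $G$ of the graph, a feasible shuffle scheme consists of messages $X_k\in\{0,1\}^{c_k}$, $k\in[K]$, where $X_k$ is a function of the values $v_{i,j}$ with $j\in\mathcal M_k$, such that, for all possible intermediate values, each machine $k$ can recover all $v_{i,j}$ with $i\in\mathcal R_k$, $j\notin\mathcal M_k$ from the values $v_{i,j}$ with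 $j\in\mathcal M_k$ and the messages $X_{k'}$, $k'\ne k$. Let $L_A(r,G)$ be the minimum of $\frac{1}{n^2T}\sum_{k=1}^K c_k$ over all feasible shuffle schemes, and let $$L^*(r)=\inf_{A\in\mathcal A(r)}\mathbb E_{\mathcal G}\big[L_A(r,\mathcal G)\big].$$ If $p=\omega(1/n^2)$, that is, $n^2p_n\to\infty$, then, as $n\to\infty$ through the multiples of $K$, $$\lim_{n\to\infty}\frac{L^*(r)}{p}=\frac1r\Big(1-\frac rK\Big).$$ The same holds if in the definition of $\mathcal A(r)$ the condition $|\mathcal M_k|=rn/K$ for all $k$ is weakened to $\sum_{k=1}^K|\mathcal M_k|=rn$. -/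

import Mathlib

open Filter Topology MeasureTheory ProbabilityTheory

/-- Binary strings of length `T`. -/
abbrev Word (T : ℕ) : Type := Fin T → ZMod 2

/-- The unordered pairs of vertices that may be edges: all pairs of distinct vertices and,
if `loops` holds, also the self-loops. -/
def potentialEdges (loops : Prop) (n : ℕ) : Set (Sym2 (Fin n)) :=
  {e | loops ∨ ¬ e.IsDiag}

/-- The Erdős–Rényi law on undirected graphs on `Fin n` (given by their edge sets): every
potential edge is present with probability `p`, independently of the others. -/
noncomputable def erdosRenyi (loops : Prop) (n : ℕ) (p : unitInterval) :
    Measure (Set (Sym2 (Fin n))) :=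
  setBernoulli (potentialEdges loops n) p

/-- The sets `M k` of vertices mapped by, and `R k` of vertices reduced by, each machine `k`. -/
structure Allocation (K n : ℕ) where
  /-- vertices whose files are stored and mapped by each machine -/
  M : Fin K → Finset (Fin n)
  /-- vertices whose Reduce computations are assigned to each machine -/
  R : Fin K → Finset (Fin n)

/-- Allocations of computation load `r`: every vertex is mapped by some machine,
`∑ₖ |Mₖ| = r n`, and the `Rₖ` partition the vertices into `K` parts of equal size `n / K`. -/
def allocations (K n r : ℕ) : Set (Allocation K n) :=
  {A | (∀ i, ∃ k, i ∈ A.M k) ∧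
    ∑ k, (A.M k).card = r * n ∧
    (∀ i, ∃ k, i ∈ A.R k) ∧
    (∀ k l, k ≠ l → Disjoint (A.R k) (A.R l)) ∧
    ∀ k, K * (A.R k).card = n}

/-- The allocations of load `r` in which every machine maps the same number `r n / K` of
vertices. -/
def balancedAllocations (K n r : ℕ) : Set (Allocation K n) :=
  {A | A ∈ allocations K n r ∧ ∀ k, K * (A.M k).card = r * n}

/-- Indices `(i, j)` of the intermediate values `v_{i,j}`: there is one for every ordered pair
such that `j` is a neighbour of `i` in the graph with edge set `E`. -/
abbrev ValueIdx {n : ℕ} (E : Set (Sym2 (Fin n))) : Type :=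
  {e : Fin n × Fin n // s(e.1, e.2) ∈ E}

/-- Indices `(i, j)` of the intermediate values that machine `k` computes in the Map phase. -/
abbrev LocalIdx {K n : ℕ} (A : Allocation K n) (E : Set (Sym2 (Fin n))) (k : Fin K) : Type :=
  {e : ValueIdx E // e.1.2 ∈ A.M k}

/-- Indices `(i, j)` of the intermediate values that machine `k` needs for its Reduce
computations but does not compute itself. -/
abbrev NeededIdx {K n : ℕ} (A : Allocation K n) (E : Set (Sym2 (Fin n))) (k : Fin K) : Type :=
  {e : ValueIdx E // e.1.1 ∈ A.R k ∧ e.1.2 ∉ A.M k}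

/-- A feasible Shuffle coding scheme for the allocation `A` on the graph with edge set `E`, with
intermediate values of `T` bits. Machine `k` multicasts a message of `c k` bits computed from its
local intermediate values; from the messages of the other machines and its own local values every
machine recovers all the values it needs, whatever the intermediate values are. -/
structure ShuffleScheme {K n : ℕ} (A : Allocation K n) (E : Set (Sym2 (Fin n))) (T : ℕ) where
  /-- message lengths in bits -/
  c : Fin K → ℕ
  /-- the message of machine `k` -/
  encode : ∀ k, (LocalIdx A E k → Word T) → Word (c k)
  /-- recovery at machine `k` -/
  decode : ∀ k, (LocalIdx A E k → Word T) → (∀ l : {l : Fin K // l ≠ k}, Word (c l.1)) →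
    NeededIdx A E k → Word T
  correct : ∀ (v : ValueIdx E → Word T) (k : Fin K) (e : NeededIdx A E k),
    decode k (fun d => v d.1) (fun l => encode l.1 (fun d => v d.1)) e = v e.1

/-- The normalized communication load `(∑ₖ cₖ) / (n² T)` of a Shuffle scheme. -/
noncomputable def ShuffleScheme.load {K n : ℕ} {A : Allocation K n} {E : Set (Sym2 (Fin n))}
    {T : ℕ} (S : ShuffleScheme A E T) : ℝ :=
  ((∑ k, S.c k : ℕ) : ℝ) / ((n : ℝ) ^ 2 * (T : ℝ))

/-- `L_A(r, G)`: the minimum normalized load over all feasible Shuffle schemes. -/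
noncomputable def minLoad {K n : ℕ} (A : Allocation K n) (T : ℕ) (E : Set (Sym2 (Fin n))) : ℝ :=
  ⨅ S : ShuffleScheme A E T, S.load

/-- The infimum, over the allocations in `𝒜`, of the average over the Erdős–Rényi graph of the
minimum normalized load. With `𝒜` the allocations of load `r` this is `L*(r)`. -/
noncomputable def minAvgLoad {K n : ℕ} (𝒜 : Set (Allocation K n)) (T : ℕ) (loops : Prop)
    (p : unitInterval) : ℝ :=
  ⨅ A : 𝒜, ∫ E, minLoad A.1 T E ∂(erdosRenyi loops n p)

/-!
Converse: fix a graph and count the possible outcomes of the messages. By induction on a set `S` of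
machines, once everything known outside `S` is revealed, the logarithm of this count is at least the
number of values that machines of `S` still need, each weighted by `1 / (number of machines knowing
it)`. The step averages over the `k ∈ S` the bound in which the knowledge of `k` is also revealed.
After taking expectations, the inequality between harmonic and arithmetic means turns the
weights into `1 / r`.

Achievability: each vertex is mapped by exactly `r` machines, so that a group of `r + 1` machines
can serve all its members at once by XOR-ing bits that each of the other members already knows. The
length is governed by the largest of boundedly many edge counts. Their standard deviations are of
order `n √p`, which together with the rounding is negligible against `n² p` when `p ≫ 1 / n²`.
-/

section HartleyEntropy

variable {α β γ : Type*} [DecidableEq β] [DecidableEq γ]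

/-- The Hartley (zero-error) entropy of a function on a finite set: the logarithm of the number of
its values there. It replaces Shannon entropy in the converse because intermediate values are
arbitrary rather than random. -/
noncomputable def hartleyEntropy (f : α → β) (s : Finset α) : ℝ :=
  Real.log (s.image f).card

theorem hartleyEntropy_nonneg (f : α → β) (s : Finset α) : 0 ≤ hartleyEntropy f s :=
  Real.log_natCast_nonneg _

theorem hartleyEntropy_mono (f : α → β) {s t : Finset α} (h : s ⊆ t) :
    hartleyEntropy f s ≤ hartleyEntropy f t := by
  rcases s.eq_empty_or_nonempty with rfl | hs
  · simpa [hartleyEntropy] using hartleyEntropy_nonneg f t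
  · have : 0 < (s.image f).card := (hs.image f).card_pos
    unfold hartleyEntropy
    gcongr

theorem hartleyEntropy_le_log_card [Fintype β] (f : α → β) (s : Finset α) :
    hartleyEntropy f s ≤ Real.log (Fintype.card β) := by
  rcases s.eq_empty_or_nonempty with rfl | hs
  · simpa [hartleyEntropy] using Real.log_natCast_nonneg _
  · have : 0 < (s.image f).card := (hs.image f).card_pos
    unfold hartleyEntropy
    gcongr
    exact Finset.card_le_univ _

theorem hartleyEntropy_eq_zero {f : α → β} {s : Finset α}
    (h : ∀ v ∈ s, ∀ w ∈ s, f v = f w) : hartleyEntropy f s = 0 := by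
  have hcard : (s.image f).card ≤ 1 := Finset.card_le_one.2 <| by
    simpa only [Finset.forall_mem_image] using h
  unfold hartleyEntropy
  interval_cases (s.image f).card <;> simp

theorem hartleyEntropy_add_le {f : α → β} {g : α → γ} {s : Finset α} {m : ℝ}
    (hs : s.Nonempty) (hfg : ∀ v ∈ s, ∀ w ∈ s, f v = f w → g v = g w)
    (hm : ∀ v ∈ s, m ≤ hartleyEntropy f {w ∈ s | g w = g v}) :
    hartleyEntropy g s + m ≤ hartleyEntropy f s := by
  classical
  have hfibre : ∀ c ∈ s.image g, Real.exp m ≤ (({w ∈ s | g w = c}).image f).card := by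
    rw [Finset.forall_mem_image]
    intro v hv
    have hne : ({w ∈ s | g w = g v}).Nonempty := ⟨v, by simp [hv]⟩
    have hpos : 0 < (({w ∈ s | g w = g v}).image f).card := (hne.image f).card_pos
    rw [← Real.le_log_iff_exp_le (by exact_mod_cast hpos)]
    exact hm v hv
  have hdisj : ∀ c ∈ s.image g, ∀ d ∈ s.image g, c ≠ d →
      Disjoint (({w ∈ s | g w = c}).image f) (({w ∈ s | g w = d}).image f) := by
    intro c _ d _ hcd
    simp only [Finset.disjoint_left, Finset.mem_image, Finset.mem_filter]
    rintro _ ⟨v, ⟨hv, rfl⟩, rfl⟩ ⟨w, ⟨hw, rfl⟩, hwv⟩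
    exact hcd (hfg v hv w hw hwv.symm)
  have hcard : (s.image g).card * Real.exp m ≤ (s.image f).card := calc
    _ = ∑ _c ∈ s.image g, Real.exp m := by rw [Finset.sum_const, nsmul_eq_mul]
    _ ≤ ∑ c ∈ s.image g, ((({w ∈ s | g w = c}).image f).card : ℝ) := Finset.sum_le_sum hfibre
    _ = (((s.image g).biUnion fun c => ({w ∈ s | g w = c}).image f).card : ℝ) := by
      rw [Finset.card_biUnion hdisj, Nat.cast_sum]
    _ ≤ (s.image f).card := by
      gcongr
      exact Finset.biUnion_subset.2 fun c _ => Finset.image_subset_image (Finset.filter_subset _ s)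
  have hpos : 0 < ((s.image g).card : ℝ) := by exact_mod_cast (hs.image g).card_pos
  calc hartleyEntropy g s + m = Real.log ((s.image g).card * Real.exp m) := by
        rw [Real.log_mul hpos.ne' (Real.exp_ne_zero m), Real.log_exp, hartleyEntropy]
    _ ≤ hartleyEntropy f s := Real.log_le_log (by positivity) hcard

theorem hartleyEntropy_le_sum {ι : Type*} [Fintype ι] {C : ι → Type*} [∀ k, DecidableEq (C k)]
    (f : α → ∀ k, C k) {s : Finset α} (hs : s.Nonempty) :
    hartleyEntropy f s ≤ ∑ k, hartleyEntropy (f · k) s := by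
  classical
  have hsub : s.image f ⊆ Fintype.piFinset fun k => s.image (f · k) := by
    simp only [Finset.image_subset_iff, Fintype.mem_piFinset]
    exact fun v hv k => Finset.mem_image_of_mem _ hv
  have : 0 < (s.image f).card := (hs.image f).card_pos
  calc hartleyEntropy f s
      ≤ Real.log (Fintype.piFinset fun k => s.image (f · k)).card := by
        unfold hartleyEntropy; gcongr
    _ = ∑ k, hartleyEntropy (f · k) s := by
        rw [Fintype.card_piFinset, Nat.cast_prod, Real.log_prod]
        · rfl
        · exact fun k _ => by exact_mod_cast (hs.image _).card_pos.ne'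

end HartleyEntropy

section Variations

variable {V W : Type*} [Fintype V] [DecidableEq V] [Fintype W] {I J : Finset V} {v v₀ : V → W}

/-- The functions that agree with `v₀` outside `I`: the outcomes that remain possible once the
values outside `I` have been revealed. -/
def variations (I : Finset V) (v₀ : V → W) : Finset (V → W) :=
  Fintype.piFinset fun e => if e ∈ I then Finset.univ else {v₀ e}

theorem mem_variations : v ∈ variations I v₀ ↔ ∀ e ∉ I, v e = v₀ e := by
  simp only [variations, Fintype.mem_piFinset]
  refine forall_congr' fun e => ?_
  by_cases he : e ∈ I <;> simp [he]

theorem self_mem_variations (I : Finset V) (v₀ : V → W) : v₀ ∈ variations I v₀ :=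
  mem_variations.2 fun _ _ => rfl

theorem variations_nonempty (I : Finset V) (v₀ : V → W) : (variations I v₀).Nonempty :=
  ⟨v₀, self_mem_variations I v₀⟩

theorem variations_subset (hJI : J ⊆ I) (hv : v ∈ variations I v₀) :
    variations J v ⊆ variations I v₀ := fun _ hw => mem_variations.2 fun e he =>
  (mem_variations.1 hw e fun heJ => he (hJI heJ)).trans (mem_variations.1 hv e he)

theorem hartleyEntropy_restrict_variations [DecidableEq W] (hJI : J ⊆ I) (v₀ : V → W) :
    hartleyEntropy J.restrict (variations I v₀) = J.card * Real.log (Fintype.card W) := by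
  have himage : (variations I v₀).image J.restrict = Finset.univ := by
    refine Finset.eq_univ_of_forall fun u => Finset.mem_image.2
      ⟨fun e => if he : e ∈ J then u ⟨e, he⟩ else v₀ e, mem_variations.2 fun e he => ?_, ?_⟩
    · exact dif_neg fun heJ => he (hJI heJ)
    · ext e
      simp
  rw [hartleyEntropy, himage, Finset.card_univ, Fintype.card_fun, Fintype.card_coe,
    Nat.cast_pow, Real.log_pow]

end Variations

section Converse

variable {ι V W : Type*} [DecidableEq ι] {C : ι → Type*}

/-- Zero-error coding of a shuffle: the value `v e` is known to the machines in `U e` and is to be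
recovered by the machine `o e`. The message `X v k` of machine `k` depends only on the values known
to `k`, and these values together with all messages determine the values that `k` is to recover. -/
structure IsShuffleCode (U : V → Finset ι) (o : V → ι) (X : (V → W) → ∀ k, C k) : Prop where
  message_congr : ∀ {v w k}, (∀ e, k ∈ U e → v e = w e) → X v k = X w k
  recover : ∀ {v w k}, (∀ e, k ∈ U e → v e = w e) → X v = X w → ∀ e, o e = k → v e = w e

variable [Fintype V] {U : V → Finset ι} {o : V → ι}

/-- The values known only inside the set `S` of machines and demanded by a machine of `S` that does
not know them. -/
def demands (U : V → Finset ι) (o : V → ι) (S : Finset ι) : Finset V :=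
  {e | U e ⊆ S ∧ o e ∈ S ∧ o e ∉ U e}

/-- The number of demanded values inside `S`, each counted with the inverse of the number of
machines knowing it. In units of one value this bounds the total message length from below. -/
noncomputable def demandWeight (U : V → Finset ι) (o : V → ι) (S : Finset ι) : ℝ :=
  ∑ e ∈ demands U o S, 1 / ((U e).card : ℝ)

theorem mem_demands {S : Finset ι} {e : V} :
    e ∈ demands U o S ↔ U e ⊆ S ∧ o e ∈ S ∧ o e ∉ U e := by
  simp [demands]

theorem demands_erase (U : V → Finset ι) (o : V → ι) (S : Finset ι) (k : ι) :
    demands U o (S.erase k) = {e ∈ demands U o S | k ∉ insert (o e) (U e)} := by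
  ext e
  simp only [mem_demands, Finset.mem_filter, Finset.subset_erase, Finset.mem_erase,
    Finset.mem_insert, not_or, ne_comm (a := k)]
  tauto

theorem demands_eq_empty (hU : ∀ e, (U e).Nonempty) {S : Finset ι} (hS : S.card ≤ 1) :
    demands U o S = ∅ := by
  refine Finset.eq_empty_of_forall_notMem fun e he => ?_
  obtain ⟨hUS, hoS, hoU⟩ := mem_demands.1 he
  obtain ⟨k, hk⟩ := hU e
  exact hoU (Finset.card_le_one.1 hS k (hUS hk) (o e) hoS ▸ hk)

theorem sum_card_add_demandWeight_erase (hU : ∀ e, (U e).Nonempty) (S : Finset ι) :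
    ∑ k ∈ S, (({e ∈ demands U o S | o e = k}.card : ℝ) + demandWeight U o (S.erase k)) =
      (S.card - 1) * demandWeight U o S := by
  have hdemanded : ∑ k ∈ S, ({e ∈ demands U o S | o e = k}.card : ℝ) = (demands U o S).card := by
    rw [Finset.card_eq_sum_card_fiberwise (f := o) (t := S) fun e he => (mem_demands.1 he).2.1,
      Nat.cast_sum]
  have hothers : ∀ e ∈ demands U o S,
      ({k ∈ S | k ∉ insert (o e) (U e)}.card : ℝ) = S.card - ((U e).card + 1) := by
    intro e he
    obtain ⟨hUS, hoS, hoU⟩ := mem_demands.1 he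
    rw [Finset.filter_notMem_eq_sdiff, Finset.cast_card_sdiff (Finset.insert_subset hoS hUS),
      Finset.card_insert_of_notMem hoU, Nat.cast_succ]
  have hweight : ∑ k ∈ S, demandWeight U o (S.erase k) =
      ∑ e ∈ demands U o S, (S.card - ((U e).card + 1)) * (1 / ((U e).card : ℝ)) := by
    simp only [demandWeight, demands_erase, Finset.sum_filter]
    rw [Finset.sum_comm]
    refine Finset.sum_congr rfl fun e he => ?_
    rw [← Finset.sum_filter, Finset.sum_const, nsmul_eq_mul, hothers e he]
  rw [Finset.sum_add_distrib, hdemanded, hweight, demandWeight, Finset.card_eq_sum_ones,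
    Nat.cast_sum, ← Finset.sum_add_distrib, Finset.mul_sum]
  refine Finset.sum_congr rfl fun e _ => ?_
  have hpos : ((U e).card : ℝ) ≠ 0 := by exact_mod_cast (hU e).card_pos.ne'
  field_simp
  push_cast
  ring

variable [Fintype ι] [DecidableEq V] [Fintype W] [∀ k, DecidableEq (C k)]
  {X : (V → W) → ∀ k, C k}

theorem IsShuffleCode.hartleyEntropy_le_sum_mem (hX : IsShuffleCode U o X) (S : Finset ι)
    (v₀ : V → W) :
    hartleyEntropy X (variations (demands U o S) v₀) ≤
      ∑ k ∈ S, hartleyEntropy (X · k) (variations (demands U o S) v₀) := by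
  refine (hartleyEntropy_le_sum X (variations_nonempty _ v₀)).trans_eq
    (Finset.sum_subset (Finset.subset_univ S) fun k _ hkS => ?_).symm
  refine hartleyEntropy_eq_zero fun v hv w hw => hX.message_congr fun e hk => ?_
  have he : e ∉ demands U o S := fun he => hkS ((mem_demands.1 he).1 hk)
  exact (mem_variations.1 hv e he).trans (mem_variations.1 hw e he).symm

-- Given what `k` knows, the messages determine the values demanded by `k`, and the demands among
-- the other machines remain unconstrained after those values are revealed.
theorem IsShuffleCode.card_mul_log_add_le (hX : IsShuffleCode U o X) {S : Finset ι} {k : ι} {m : ℝ}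
    (hm : ∀ v, m ≤ hartleyEntropy X (variations (demands U o (S.erase k)) v)) (v₀ : V → W) :
    {e ∈ demands U o S | o e = k}.card * Real.log (Fintype.card W) + m ≤
      hartleyEntropy X (variations {e ∈ demands U o S | k ∉ U e} v₀) := by
  classical
  set demanded := {e ∈ demands U o S | o e = k}
  set unknown := {e ∈ demands U o S | k ∉ U e}
  have hsub : demanded ⊆ unknown := fun e he => by
    rw [Finset.mem_filter] at he ⊢
    exact ⟨he.1, he.2 ▸ (mem_demands.1 he.1).2.2⟩
  have hknown : ∀ v ∈ variations unknown v₀, ∀ e, k ∈ U e → v e = v₀ e := fun v hv e hk =>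
    mem_variations.1 hv e fun he => (Finset.mem_filter.1 he).2 hk
  rw [← hartleyEntropy_restrict_variations hsub v₀]
  refine hartleyEntropy_add_le (variations_nonempty _ _) (fun v hv w hw hvw => ?_) fun v hv => ?_
  · ext ⟨e, he⟩
    exact hX.recover (fun e hk => (hknown v hv e hk).trans (hknown w hw e hk).symm) hvw e
      (Finset.mem_filter.1 he).2
  · refine (hm v).trans (hartleyEntropy_mono X fun w hw => Finset.mem_filter.2 ⟨?_, ?_⟩)
    · refine variations_subset (fun e he => ?_) hv hw
      rw [demands_erase, Finset.mem_filter, Finset.mem_insert, not_or] at he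
      exact Finset.mem_filter.2 ⟨he.1, he.2.2⟩
    · ext ⟨e, he⟩
      refine mem_variations.1 hw e fun he' => ?_
      exact Finset.ne_of_mem_erase (mem_demands.1 he').2.1 (Finset.mem_filter.1 he).2

theorem IsShuffleCode.hartleyEntropy_message_add_le (hX : IsShuffleCode U o X) {S : Finset ι}
    {k : ι} {m : ℝ} (hm : ∀ v, m ≤ hartleyEntropy X (variations (demands U o (S.erase k)) v))
    (v₀ : V → W) :
    hartleyEntropy (X · k) (variations (demands U o S) v₀) +
      ({e ∈ demands U o S | o e = k}.card * Real.log (Fintype.card W) + m) ≤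
        hartleyEntropy X (variations (demands U o S) v₀) := by
  refine hartleyEntropy_add_le (variations_nonempty _ _) (fun v _ w _ h => congrFun h k)
    fun v hv => (hX.card_mul_log_add_le hm v).trans (hartleyEntropy_mono X fun w hw => ?_)
  refine Finset.mem_filter.2 ⟨variations_subset (Finset.filter_subset _ _) hv hw, ?_⟩
  exact hX.message_congr fun e hk =>
    mem_variations.1 hw e fun he => (Finset.mem_filter.1 he).2 hk

theorem IsShuffleCode.demandWeight_mul_log_le (hX : IsShuffleCode U o X)
    (hU : ∀ e, (U e).Nonempty) (S : Finset ι) (v₀ : V → W) :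
    demandWeight U o S * Real.log (Fintype.card W) ≤
      hartleyEntropy X (variations (demands U o S) v₀) := by
  induction S using Finset.strongInduction generalizing v₀ with
  | H S ih =>
    rcases le_or_gt S.card 1 with hS | hS
    · simpa [demandWeight, demands_eq_empty hU hS] using hartleyEntropy_nonneg X _
    set h := hartleyEntropy X (variations (demands U o S) v₀)
    set b := Real.log (Fintype.card W)
    have hsum : h + (S.card - 1) * demandWeight U o S * b ≤ S.card * h := calc
      _ ≤ ∑ k ∈ S, hartleyEntropy (X · k) (variations (demands U o S) v₀) +
            (∑ k ∈ S, (({e ∈ demands U o S | o e = k}.card : ℝ) +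
              demandWeight U o (S.erase k))) * b := by
          rw [sum_card_add_demandWeight_erase hU]
          gcongr
          exact hX.hartleyEntropy_le_sum_mem S v₀
      _ = ∑ k ∈ S, (hartleyEntropy (X · k) (variations (demands U o S) v₀) +
            ({e ∈ demands U o S | o e = k}.card * b + demandWeight U o (S.erase k) * b)) := by
          simp only [Finset.sum_mul, Finset.sum_add_distrib, add_mul]
      _ ≤ ∑ _k ∈ S, h := Finset.sum_le_sum fun k hk =>
          hX.hartleyEntropy_message_add_le (ih _ (Finset.erase_ssubset hk)) v₀
      _ = S.card * h := by rw [Finset.sum_const, nsmul_eq_mul]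
    have hpos : (0 : ℝ) < S.card - 1 := sub_pos.2 (by exact_mod_cast hS)
    refine le_of_mul_le_mul_left ?_ hpos
    linarith

end Converse

section Moments

variable {Ω : Type*} [MeasurableSpace Ω] {μ : Measure Ω}

theorem integrable_iSup {ι : Type*} [Finite ι] [Nonempty ι] {X : ι → Ω → ℝ}
    (hX : ∀ i, Integrable (X i) μ) : Integrable (fun ω => ⨆ i, X i ω) μ := by
  cases nonempty_fintype ι
  have h : Integrable (Finset.univ.sup' Finset.univ_nonempty X) μ :=
    Finset.sup'_induction _ X (p := (Integrable · μ)) (fun _ hf _ hg => hf.sup hg) fun i _ => hX i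
  refine h.congr (Eventually.of_forall fun ω => ?_)
  simp only [Finset.sup'_apply, Finset.sup'_univ_eq_ciSup]

variable [IsProbabilityMeasure μ]

theorem integral_abs_sub_integral_le_sqrt_variance {X : Ω → ℝ} (hX : MemLp X 2 μ) :
    ∫ ω, |X ω - ∫ x, X x ∂μ| ∂μ ≤ √(Var[X; μ]) := by
  have hY : MemLp (fun ω => |X ω - ∫ x, X x ∂μ|) 2 μ := (hX.sub (memLp_const _)).abs
  have hsq : (∫ ω, |X ω - ∫ x, X x ∂μ| ∂μ) ^ 2 ≤ Var[X; μ] := by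
    have h := variance_nonneg (fun ω => |X ω - ∫ x, X x ∂μ|) μ
    rw [variance_eq_sub hY, sub_nonneg] at h
    simpa only [variance_eq_integral hX.aemeasurable, Pi.pow_apply, sq_abs] using h
  exact Real.le_sqrt_of_sq_le hsq

theorem integral_iSup_le_add_sum_sqrt_variance {ι : Type*} [Fintype ι] [Nonempty ι]
    {X : ι → Ω → ℝ} (hX : ∀ i, MemLp (X i) 2 μ) {m : ℝ} (hm : ∀ i, ∫ ω, X i ω ∂μ ≤ m) :
    ∫ ω, ⨆ i, X i ω ∂μ ≤ m + ∑ i, √(Var[X i; μ]) := by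
  have hXint : ∀ i, Integrable (X i) μ := fun i => (hX i).integrable one_le_two
  have hdev : ∀ i, Integrable (fun ω => |X i ω - ∫ x, X i x ∂μ|) μ := fun i =>
    ((hXint i).sub (integrable_const _)).abs
  have hsup : ∀ ω, ⨆ i, X i ω ≤ m + ∑ i, |X i ω - ∫ x, X i x ∂μ| := fun ω =>
    ciSup_le fun i => calc
      X i ω ≤ m + |X i ω - ∫ x, X i x ∂μ| := by
        linarith [le_abs_self (X i ω - ∫ x, X i x ∂μ), hm i]
      _ ≤ _ := by
        gcongr
        exact Finset.single_le_sum (f := fun i => |X i ω - ∫ x, X i x ∂μ|)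
          (fun _ _ => abs_nonneg _) (Finset.mem_univ i)
  calc ∫ ω, ⨆ i, X i ω ∂μ
      ≤ ∫ ω, (m + ∑ i, |X i ω - ∫ x, X i x ∂μ|) ∂μ :=
        integral_mono (integrable_iSup hXint)
          ((integrable_const m).add (integrable_finsetSum _ fun i _ => hdev i)) hsup
    _ = m + ∑ i, ∫ ω, |X i ω - ∫ x, X i x ∂μ| ∂μ := by
        rw [integral_add (integrable_const m) (integrable_finsetSum _ fun i _ => hdev i),
          integral_finsetSum _ fun i _ => hdev i, integral_const, probReal_univ, one_smul]
    _ ≤ m + ∑ i, √(Var[X i; μ]) := by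
        gcongr with i
        exact integral_abs_sub_integral_le_sqrt_variance (hX i)

end Moments

section SetBernoulli

open unitInterval

variable {ι : Type*} {u : Set ι} {p : I}

theorem map_mem_setBernoulli (u : Set ι) (p : I) :
    (setBernoulli u p).map (fun E i => i ∈ E) = Measure.infinitePi fun i =>
      toNNReal p • Measure.dirac (i ∈ u) + toNNReal (σ p) • Measure.dirac False := by
  rw [setBernoulli_eq_map, Measure.map_map (by fun_prop) (by fun_prop)]
  exact Measure.map_id

theorem map_mem_apply_setBernoulli (u : Set ι) (p : I) (i : ι) :
    (setBernoulli u p).map (fun E => i ∈ E) =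
      toNNReal p • Measure.dirac (i ∈ u) + toNNReal (σ p) • Measure.dirac False := by
  rw [← Measure.infinitePi_map_eval (fun i =>
    toNNReal p • Measure.dirac (i ∈ u) + toNNReal (σ p) • Measure.dirac False) i,
    ← map_mem_setBernoulli, Measure.map_map (by fun_prop) (by fun_prop)]
  rfl

theorem iIndepFun_mem_setBernoulli (u : Set ι) (p : I) :
    iIndepFun (fun i (E : Set ι) => i ∈ E) (setBernoulli u p) := by
  rw [iIndepFun_iff_map_fun_eq_infinitePi_map (by fun_prop), map_mem_setBernoulli]
  simp only [map_mem_apply_setBernoulli]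

theorem measurable_indicator_one_apply (i : ι) :
    Measurable fun E : Set ι => E.indicator (1 : ι → ℝ) i := by
  classical
  exact (measurable_from_top (f := fun q : Prop => if q then (1 : ℝ) else 0)).comp
    (measurable_set_mem i)

theorem memLp_indicator_setBernoulli (u : Set ι) (p : I) (i : ι) :
    MemLp (fun E : Set ι => E.indicator (1 : ι → ℝ) i) 2 (setBernoulli u p) :=
  memLp_of_bounded
    (Eventually.of_forall fun _ => ⟨Set.indicator_nonneg (fun _ _ => zero_le_one) i,
      Set.indicator_le_self' (fun _ _ => zero_le_one) i⟩)
    (measurable_indicator_one_apply i).aestronglyMeasurable 2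

theorem integral_indicator_setBernoulli (u : Set ι) (p : I) (i : ι) :
    ∫ E : Set ι, E.indicator 1 i ∂setBernoulli u p = u.indicator (fun _ => (p : ℝ)) i := by
  classical
  have hint : ∀ ν : Measure Prop, IsFiniteMeasure ν →
      Integrable (fun q : Prop => if q then (1 : ℝ) else 0) ν :=
    fun ν _ => Integrable.of_finite
  calc ∫ E : Set ι, E.indicator 1 i ∂setBernoulli u p
      = ∫ q, (if q then (1 : ℝ) else 0) ∂(setBernoulli u p).map (fun E => i ∈ E) := by
        rw [integral_map (measurable_set_mem i).aemeasurable
          measurable_from_top.aestronglyMeasurable]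
        simp only [Set.indicator_apply, Pi.one_apply]
    _ = u.indicator (fun _ => (p : ℝ)) i := by
        rw [map_mem_apply_setBernoulli,
          integral_add_measure (hint _ inferInstance) (hint _ inferInstance)]
        simp [integral_smul_nnreal_measure, Set.indicator_apply, NNReal.smul_def]

theorem covariance_indicator_setBernoulli_le (u : Set ι) (p : I) (i j : ι) [Decidable (i = j)] :
    cov[fun E : Set ι => E.indicator (1 : ι → ℝ) i, fun E => E.indicator 1 j; setBernoulli u p] ≤
      if i = j then (p : ℝ) else 0 := by
  classical
  split_ifs with hij
  · subst hij
    have hsq : ∀ E : Set ι, E.indicator (1 : ι → ℝ) i ^ 2 = E.indicator 1 i := fun E => by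
      by_cases hi : i ∈ E <;> simp [hi]
    have hmean : ∫ E : Set ι, E.indicator 1 i ∂setBernoulli u p ≤ (p : ℝ) := by
      rw [integral_indicator_setBernoulli]
      exact Set.indicator_le_self' (fun _ _ => p.2.1) i
    rw [covariance_self (measurable_indicator_one_apply i).aemeasurable,
      variance_eq_sub (memLp_indicator_setBernoulli u p i)]
    simp only [Pi.pow_apply, hsq]
    nlinarith
  · refine (IndepFun.covariance_eq_zero ?_ (memLp_indicator_setBernoulli u p i)
      (memLp_indicator_setBernoulli u p j)).le
    exact ((iIndepFun_mem_setBernoulli u p).indepFun hij).comp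
      (measurable_from_top (f := fun q : Prop => if q then (1 : ℝ) else 0))
      (measurable_from_top (f := fun q : Prop => if q then (1 : ℝ) else 0))

theorem variance_sum_indicator_setBernoulli_le {κ : Type*} [DecidableEq ι] (u : Set ι) (p : I)
    {f : κ → ι} {s : Finset κ} {c : ℕ} (hc : ∀ a ∈ s, {b ∈ s | f a = f b}.card ≤ c) :
    Var[fun E : Set ι => ∑ a ∈ s, E.indicator (1 : ι → ℝ) (f a); setBernoulli u p] ≤
      c * p * s.card := by
  rw [variance_fun_sum' fun a _ => memLp_indicator_setBernoulli u p (f a)]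
  calc _ ≤ ∑ a ∈ s, ∑ b ∈ s, if f a = f b then (p : ℝ) else 0 := by
        gcongr with a _ b _
        exact covariance_indicator_setBernoulli_le u p (f a) (f b)
    _ ≤ ∑ _a ∈ s, c * (p : ℝ) := by
        gcongr with a ha
        rw [← Finset.sum_filter, Finset.sum_const, nsmul_eq_mul]
        have := hc a ha
        have := p.2.1
        gcongr
    _ = c * p * s.card := by rw [Finset.sum_const, nsmul_eq_mul, mul_comm]

end SetBernoulli

section ArcCount

variable {n : ℕ}

open Classical in
/-- The number of ordered pairs in `P` whose unordered pair is an edge: how many intermediate values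
have their index in `P`. -/
noncomputable def arcCount (P : Finset (Fin n × Fin n)) (E : Set (Sym2 (Fin n))) : ℕ :=
  {a ∈ P | s(a.1, a.2) ∈ E}.card

theorem arcCount_eq_sum_indicator (P : Finset (Fin n × Fin n)) (E : Set (Sym2 (Fin n))) :
    (arcCount P E : ℝ) = ∑ a ∈ P, E.indicator 1 s(a.1, a.2) := by
  classical
  simp [arcCount, Set.indicator_apply]

theorem card_filter_sym2_eq_le_two (P : Finset (Fin n × Fin n)) (a : Fin n × Fin n) :
    {b ∈ P | s(a.1, a.2) = s(b.1, b.2)}.card ≤ 2 := by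
  refine (Finset.card_le_card (t := {a, a.swap}) fun b hb => ?_).trans Finset.card_le_two
  rw [Finset.mem_insert, Finset.mem_singleton]
  rcases Sym2.eq_iff.1 (Finset.mem_filter.1 hb).2 with ⟨h₁, h₂⟩ | ⟨h₁, h₂⟩
  · exact .inl (Prod.ext h₁.symm h₂.symm)
  · exact .inr (Prod.ext h₂.symm h₁.symm)

variable (loops : Prop) (p : unitInterval)

instance isProbabilityMeasure_erdosRenyi : IsProbabilityMeasure (erdosRenyi loops n p) :=
  inferInstanceAs (IsProbabilityMeasure (setBernoulli _ _))

theorem memLp_arcCount (P : Finset (Fin n × Fin n)) :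
    MemLp (fun E => (arcCount P E : ℝ)) 2 (erdosRenyi loops n p) := by
  simp only [arcCount_eq_sum_indicator]
  exact memLp_finsetSum _ fun a _ => memLp_indicator_setBernoulli _ p s(a.1, a.2)

theorem integral_arcCount_le (P : Finset (Fin n × Fin n)) :
    ∫ E, (arcCount P E : ℝ) ∂erdosRenyi loops n p ≤ p * P.card := by
  simp only [arcCount_eq_sum_indicator, erdosRenyi]
  rw [integral_finsetSum _ fun a _ =>
    (memLp_indicator_setBernoulli _ p s(a.1, a.2)).integrable one_le_two]
  calc _ ≤ ∑ _a ∈ P, (p : ℝ) := by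
        gcongr with a
        rw [integral_indicator_setBernoulli]
        exact Set.indicator_le_self' (fun _ _ => p.2.1) _
    _ = p * P.card := by rw [Finset.sum_const, nsmul_eq_mul, mul_comm]

theorem variance_arcCount_le (P : Finset (Fin n × Fin n)) :
    Var[fun E => (arcCount P E : ℝ); erdosRenyi loops n p] ≤ 2 * p * P.card := by
  simp only [arcCount_eq_sum_indicator]
  exact variance_sum_indicator_setBernoulli_le _ p fun a _ => card_filter_sym2_eq_le_two P a

end ArcCount

theorem exists_fiberwise_injOn {β κ γ : Type*} [DecidableEq κ] [Nonempty γ] {s : Finset β}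
    {c : β → κ} {t : κ → Finset γ} (h : ∀ x, {b ∈ s | c b = x}.card ≤ (t x).card) :
    ∃ f : β → γ, (∀ b ∈ s, f b ∈ t (c b)) ∧
      ∀ b ∈ s, ∀ b' ∈ s, c b = c b' → f b = f b' → b = b' := by
  classical
  have hfibre : ∀ x, ∃ g : β → γ, (∀ b ∈ s, c b = x → g b ∈ t x) ∧
      Set.InjOn g {b ∈ s | c b = x} := fun x => by
    obtain ⟨g, hmaps, hinj⟩ := (Finset.finite_toSet {b ∈ s | c b = x}).exists_injOn_of_encard_le
      (t := (t x : Set γ)) (by simpa only [Set.encard_coe_eq_coe_finsetCard, Nat.cast_le] using h x)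
    exact ⟨g, fun b hb hc => hmaps (by simp [hb, hc]), by simpa using hinj⟩
  choose g hmaps hinj using hfibre
  refine ⟨fun b => g (c b) b, fun b hb => hmaps _ b hb rfl, fun b hb b' hb' hc hg => ?_⟩
  exact hinj (c b') ⟨hb, hc⟩ ⟨hb', rfl⟩ (by simpa only [hc] using hg)

section Scheme

variable {K n : ℕ} {A : Allocation K n} {E : Set (Sym2 (Fin n))} {T : ℕ}

/-- The machines that map vertex `j`. -/
def Allocation.mappers (A : Allocation K n) (j : Fin n) : Finset (Fin K) :=
  {k | j ∈ A.M k}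

/-- The vertices mapped by exactly the machines of `U`. -/
def Allocation.batch (A : Allocation K n) (U : Finset (Fin K)) : Finset (Fin n) :=
  {j | A.mappers j = U}

theorem Allocation.mem_mappers {j : Fin n} {k : Fin K} : k ∈ A.mappers j ↔ j ∈ A.M k := by
  simp [Allocation.mappers]

theorem exists_shuffleScheme_of_messages {Key : Fin K → Type*} [∀ k, Fintype (Key k)]
    {X : ∀ k, (ValueIdx E → Word T) → Key k → ZMod 2}
    (hlocal : ∀ k v w, (∀ e : ValueIdx E, e.1.2 ∈ A.M k → v e = w e) → X k v = X k w)
    (hrecover : ∀ k v w, (∀ e : ValueIdx E, e.1.2 ∈ A.M k → v e = w e) →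
      (∀ l ≠ k, X l v = X l w) → ∀ e : NeededIdx A E k, v e.1 = w e.1) :
    ∃ S : ShuffleScheme A E T, ∀ k, S.c k = Fintype.card (Key k) := by
  classical
  let encode (k : Fin K) (x : LocalIdx A E k → Word T) : Word (Fintype.card (Key k)) :=
    X k (Function.extend Subtype.val x 0) ∘ (Fintype.equivFin (Key k)).symm
  have hencode : ∀ k (v : ValueIdx E → Word T),
      encode k (fun d => v d.1) = X k v ∘ (Fintype.equivFin (Key k)).symm := fun k v => by
    refine congrArg (· ∘ _) (hlocal k _ v fun e he => ?_)
    exact Subtype.val_injective.extend_apply (fun d : LocalIdx A E k => v d.1) 0 ⟨e, he⟩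
  have hunique : ∀ k (v w : ValueIdx E → Word T),
      (fun d : LocalIdx A E k => v d.1) = (fun d => w d.1) →
      (∀ l : {l // l ≠ k}, encode l.1 (fun d => v d.1) = encode l.1 (fun d => w d.1)) →
      ∀ e : NeededIdx A E k, v e.1 = w e.1 := fun k v w hvw hmsg =>
    hrecover k v w (fun e he => congrFun hvw ⟨e, he⟩) fun l hl =>
      (Equiv.surjective _).injective_comp_right <| by
        simpa only [hencode] using hmsg ⟨l, hl⟩
  let decode (k : Fin K) (x : LocalIdx A E k → Word T)
      (m : ∀ l : {l : Fin K // l ≠ k}, Word (Fintype.card (Key l.1))) (e : NeededIdx A E k) :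
      Word T :=
    if h : ∃ v : ValueIdx E → Word T,
      (fun d : LocalIdx A E k => v d.1) = x ∧ ∀ l, encode l.1 (fun d => v d.1) = m l
    then h.choose e.1 else 0
  refine ⟨⟨fun k => Fintype.card (Key k), encode, decode, fun v k e => ?_⟩, fun _ => rfl⟩
  have h : ∃ w : ValueIdx E → Word T, (fun d : LocalIdx A E k => w d.1) = (fun d => v d.1) ∧
    ∀ l : {l // l ≠ k}, encode l.1 (fun d => w d.1) = encode l.1 (fun d => v d.1) :=
    ⟨v, rfl, fun _ => rfl⟩
  refine (dif_pos h).trans ?_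
  exact hunique k _ v h.choose_spec.1 h.choose_spec.2 e

open Classical in
/-- The bits `(k, e, t)` to be delivered: bit `t` of the value `e`, which machine `k` needs. -/
noncomputable def wantedBits (A : Allocation K n) (E : Set (Sym2 (Fin n))) (T : ℕ) :
    Finset (Fin K × ValueIdx E × Fin T) :=
  {b | b.2.1.1.1 ∈ A.R b.1 ∧ b.2.1.1.2 ∉ A.M b.1}

/-- The multicast group of a wanted bit: the machine that needs it and the machines that know it. -/
def bitGroup (A : Allocation K n) (b : Fin K × ValueIdx E × Fin T) : Finset (Fin K) :=
  insert b.1 (A.mappers b.2.1.1.2)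

/-- The XOR-coded bit that machine `l` sends to the group `S` in slot `q`, when `slot` assigns to
each wanted bit its sender and the position in the sender's message. -/
noncomputable def codedBit (A : Allocation K n) (slot : Fin K × ValueIdx E × Fin T → Fin K × ℕ)
    (l : Fin K) (S : Finset (Fin K)) (q : ℕ) (v : ValueIdx E → Word T) : ZMod 2 :=
  ∑ b ∈ wantedBits A E T with bitGroup A b = S ∧ slot b = (l, q), v b.2.1 b.2.2

theorem mem_wantedBits {b : Fin K × ValueIdx E × Fin T} :
    b ∈ wantedBits A E T ↔ b.2.1.1.1 ∈ A.R b.1 ∧ b.2.1.1.2 ∉ A.M b.1 := by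
  simp [wantedBits]

theorem mappers_eq_bitGroup_erase {b : Fin K × ValueIdx E × Fin T} (hb : b ∈ wantedBits A E T) :
    A.mappers b.2.1.1.2 = (bitGroup A b).erase b.1 := by
  rw [bitGroup, Finset.erase_insert]
  exact mt Allocation.mem_mappers.1 (mem_wantedBits.1 hb).2

theorem card_wantedBits_le (A : Allocation K n) (E : Set (Sym2 (Fin n))) (T : ℕ) (k : Fin K)
    (U : Finset (Fin K)) :
    {b ∈ wantedBits A E T | (b.1, A.mappers b.2.1.1.2) = (k, U)}.card ≤
      T * arcCount (A.R k ×ˢ A.batch U) E := by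
  classical
  have hcard := Finset.card_product (Finset.univ : Finset (Fin T))
    {a ∈ A.R k ×ˢ A.batch U | s(a.1, a.2) ∈ E}
  rw [Finset.card_univ, Fintype.card_fin] at hcard
  rw [arcCount, ← hcard]
  refine Finset.card_le_card_of_injOn (fun b => (b.2.2, b.2.1.1)) (fun b hb => ?_) ?_
  · obtain ⟨hb, hkU⟩ := Finset.mem_filter.1 hb
    have hneeds := (mem_wantedBits.1 hb).1
    obtain ⟨rfl, rfl⟩ := Prod.mk.inj hkU
    simp [Allocation.batch, hneeds, b.2.1.2]
  · rintro ⟨k, e, t⟩ hb ⟨k', e', t'⟩ hb' h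
    simp_all [Subtype.ext_iff]

theorem codedBit_congr {slot : Fin K × ValueIdx E × Fin T → Fin K × ℕ}
    (hslot : ∀ b ∈ wantedBits A E T, (slot b).1 ∈ A.mappers b.2.1.1.2) {l : Fin K}
    {v w : ValueIdx E → Word T} (hvw : ∀ e : ValueIdx E, e.1.2 ∈ A.M l → v e = w e)
    (S : Finset (Fin K)) (q : ℕ) : codedBit A slot l S q v = codedBit A slot l S q w := by
  refine Finset.sum_congr rfl fun b hb => ?_
  obtain ⟨hb, -, hlq⟩ := Finset.mem_filter.1 hb
  have hl := Allocation.mem_mappers.1 (hslot b hb)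
  rw [hlq] at hl
  rw [hvw b.2.1 hl]

-- Every other bit in the slot of `b` is needed by another machine of the group, hence known to the
-- machine that needs `b`.
theorem eq_of_codedBit_eq {slot : Fin K × ValueIdx E × Fin T → Fin K × ℕ}
    (hinj : ∀ b ∈ wantedBits A E T, ∀ b' ∈ wantedBits A E T,
      (b.1, A.mappers b.2.1.1.2) = (b'.1, A.mappers b'.2.1.1.2) → slot b = slot b' → b = b')
    {b : Fin K × ValueIdx E × Fin T} (hb : b ∈ wantedBits A E T) {v w : ValueIdx E → Word T}
    (hvw : ∀ e : ValueIdx E, e.1.2 ∈ A.M b.1 → v e = w e)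
    (hcoded : codedBit A slot (slot b).1 (bitGroup A b) (slot b).2 v =
      codedBit A slot (slot b).1 (bitGroup A b) (slot b).2 w) :
    v b.2.1 b.2.2 = w b.2.1 b.2.2 := by
  classical
  have hmem : b ∈ {b' ∈ wantedBits A E T |
      bitGroup A b' = bitGroup A b ∧ slot b' = ((slot b).1, (slot b).2)} := by simp [hb]
  rw [codedBit, codedBit, ← Finset.add_sum_erase _ _ hmem,
    ← Finset.add_sum_erase _ _ hmem] at hcoded
  refine add_right_cancel (hcoded.trans (congrArg _ (Finset.sum_congr rfl fun b' hb' => ?_)).symm)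
  obtain ⟨hne, hb'⟩ := Finset.mem_erase.1 hb'
  obtain ⟨hb', hgroup, hslot⟩ := Finset.mem_filter.1 hb'
  have hneeder : b.1 ≠ b'.1 := fun h => hne <| hinj b' hb' b hb
    (by rw [mappers_eq_bitGroup_erase hb', mappers_eq_bitGroup_erase hb, hgroup, h]) hslot
  have hknows : b.1 ∈ A.mappers b'.2.1.1.2 := by
    rw [mappers_eq_bitGroup_erase hb', hgroup]
    exact Finset.mem_erase.2 ⟨hneeder, Finset.mem_insert_self _ _⟩
  rw [hvw b'.2.1 (Allocation.mem_mappers.1 hknows)]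

theorem exists_slot [NeZero K] {len : Finset (Fin K) → ℕ}
    (hlen : ∀ k U, k ∉ U → T * arcCount (A.R k ×ˢ A.batch U) E ≤ U.card * len (insert k U)) :
    ∃ slot : Fin K × ValueIdx E × Fin T → Fin K × ℕ,
      (∀ b ∈ wantedBits A E T,
        (slot b).1 ∈ A.mappers b.2.1.1.2 ∧ (slot b).2 < len (bitGroup A b)) ∧
      ∀ b ∈ wantedBits A E T, ∀ b' ∈ wantedBits A E T,
        (b.1, A.mappers b.2.1.1.2) = (b'.1, A.mappers b'.2.1.1.2) → slot b = slot b' → b = b' := by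
  obtain ⟨slot, hslot, hinj⟩ := exists_fiberwise_injOn (s := wantedBits A E T)
    (c := fun b => (b.1, A.mappers b.2.1.1.2))
    (t := fun x => x.2 ×ˢ Finset.range (len (insert x.1 x.2))) fun ⟨k, U⟩ => by
      by_cases hk : k ∈ U
      · refine (Finset.card_eq_zero.2 (Finset.filter_eq_empty_iff.2 fun b hb h => ?_)).trans_le
          (Nat.zero_le _)
        obtain ⟨rfl, rfl⟩ := Prod.mk.inj h
        exact (mem_wantedBits.1 hb).2 (Allocation.mem_mappers.1 hk)
      · rw [Finset.card_product, Finset.card_range]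
        exact (card_wantedBits_le A E T k U).trans (hlen k U hk)
  simp only [Finset.mem_product, Finset.mem_range] at hslot
  exact ⟨slot, hslot, hinj⟩

theorem exists_codedShuffleScheme [NeZero K] (len : Finset (Fin K) → ℕ)
    (hlen : ∀ k U, k ∉ U → T * arcCount (A.R k ×ˢ A.batch U) E ≤ U.card * len (insert k U)) :
    ∃ S : ShuffleScheme A E T, ∑ k, S.c k = ∑ G, G.card * len G := by
  classical
  obtain ⟨slot, hslot, hinj⟩ := exists_slot hlen
  obtain ⟨S, hS⟩ := exists_shuffleScheme_of_messages (A := A) (E := E) (T := T)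
    (Key := fun l => (G : {G : Finset (Fin K) // l ∈ G}) × Fin (len G))
    (X := fun l v x => codedBit A slot l x.1 x.2 v)
    (fun l v w hvw => funext fun x => codedBit_congr (fun b hb => (hslot b hb).1) hvw _ _)
    (fun k v w hvw hmsg e => funext fun t => by
      have hb : (k, e.1, t) ∈ wantedBits A E T := mem_wantedBits.2 e.2
      obtain ⟨hl, hq⟩ := hslot _ hb
      refine eq_of_codedBit_eq hinj hb hvw ?_
      exact congrFun (hmsg _ (ne_of_mem_of_not_mem hl (mt Allocation.mem_mappers.1 e.2.2)))
        ⟨⟨bitGroup A (k, e.1, t), Finset.mem_insert_of_mem hl⟩, ⟨_, hq⟩⟩)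
  have hcard : ∀ l, S.c l = ∑ G with l ∈ G, len G := fun l => by
    rw [hS, Fintype.card_sigma]
    simp only [Fintype.card_fin]
    exact (Finset.sum_subtype _ (by simp) _).symm
  refine ⟨S, ?_⟩
  simp only [hcard]
  rw [Finset.sum_comm' (t' := Finset.univ) (s' := fun G => G) (by simp)]
  simp only [Finset.sum_const, smul_eq_mul]

end Scheme

section LowerBound

variable {K n : ℕ} {A : Allocation K n} {E : Set (Sym2 (Fin n))} {T : ℕ}

/-- The ordered pairs `(i, j)` such that a machine reducing `i` does not map `j`: the indices of the
intermediate values that would have to be transmitted on the complete graph. -/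
def Allocation.missing (A : Allocation K n) : Finset (Fin n × Fin n) :=
  {a | ∃ k, a.1 ∈ A.R k ∧ a.2 ∉ A.M k}

theorem Allocation.mem_missing {a : Fin n × Fin n} :
    a ∈ A.missing ↔ ∃ k, a.1 ∈ A.R k ∧ a.2 ∉ A.M k := by
  simp [Allocation.missing]

theorem Allocation.mappers_nonempty (hM : ∀ j, ∃ k, j ∈ A.M k) (j : Fin n) :
    (A.mappers j).Nonempty :=
  (hM j).imp fun _ => Allocation.mem_mappers.2

namespace ShuffleScheme

theorem isShuffleCode (S : ShuffleScheme A E T) {o : ValueIdx E → Fin K}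
    (ho : ∀ e, e.1.1 ∈ A.R (o e)) :
    IsShuffleCode (fun e : ValueIdx E => A.mappers e.1.2) o
      (fun (v : ValueIdx E → Word T) k => S.encode k fun d => v d.1) where
  message_congr h := congrArg (S.encode _) (funext fun d => h d.1 (Allocation.mem_mappers.2 d.2))
  recover := by
    rintro v w _ hvw hmsg e rfl
    by_cases he : e.1.2 ∈ A.M (o e)
    · exact hvw e (Allocation.mem_mappers.2 he)
    · have hlocal : (fun d : LocalIdx A E (o e) => v d.1) = fun d => w d.1 :=
        funext fun d => hvw d.1 (Allocation.mem_mappers.2 d.2)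
      have hothers : (fun l : {l : Fin K // l ≠ o e} => S.encode l.1 fun d => v d.1) =
          fun l : {l : Fin K // l ≠ o e} => S.encode l.1 fun d => w d.1 :=
        funext fun l => congrFun hmsg l.1
      rw [← S.correct v (o e) ⟨e, ho e, he⟩, ← S.correct w (o e) ⟨e, ho e, he⟩, hlocal, hothers]

theorem mul_sum_missing_le (S : ShuffleScheme A E T) (hM : ∀ j, ∃ k, j ∈ A.M k)
    (hR : ∀ i, ∃ k, i ∈ A.R k) :
    T * ∑ a ∈ A.missing, E.indicator 1 s(a.1, a.2) / ((A.mappers a.2).card : ℝ) ≤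
      (∑ k, S.c k : ℕ) := by
  classical
  have hneeder : ∀ e : ValueIdx E, ∃ k, e.1.1 ∈ A.R k ∧ (e.1 ∈ A.missing → e.1.2 ∉ A.M k) :=
    fun e => by
      by_cases he : e.1 ∈ A.missing
      · exact (Allocation.mem_missing.1 he).imp fun k hk => ⟨hk.1, fun _ => hk.2⟩
      · exact (hR e.1.1).imp fun k hk => ⟨hk, fun h => (he h).elim⟩
  choose o hoR hoM using hneeder
  have hweight : ∑ a ∈ A.missing, E.indicator 1 s(a.1, a.2) / ((A.mappers a.2).card : ℝ) ≤
      demandWeight (fun e : ValueIdx E => A.mappers e.1.2) o Finset.univ := calc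
    _ = ∑ a ∈ A.missing with s(a.1, a.2) ∈ E, 1 / ((A.mappers a.2).card : ℝ) := by
        simp only [Finset.sum_filter, Set.indicator_apply, Pi.one_apply, ite_div, zero_div]
    _ = ∑ e : ValueIdx E with e.1 ∈ A.missing, 1 / ((A.mappers e.1.2).card : ℝ) :=
        (Finset.sum_bij (fun e _ => e.1) (by simp +contextual) (by simp +contextual)
          (by simp +contextual) (by simp)).symm
    _ ≤ _ := Finset.sum_le_sum_of_subset_of_nonneg (fun e he => mem_demands.2
          ⟨Finset.subset_univ _, Finset.mem_univ _, mt Allocation.mem_mappers.1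
            (hoM e (Finset.mem_filter.1 he).2)⟩) fun _ _ _ => by positivity
  have hentropy := ((S.isShuffleCode hoR).demandWeight_mul_log_le
    (fun e => Allocation.mappers_nonempty hM e.1.2) Finset.univ fun _ => 0).trans
    (hartleyEntropy_le_log_card _ _)
  simp only [Fintype.card_fun, Fintype.card_pi, ZMod.card, Fintype.card_fin,
    Finset.prod_pow_eq_pow_sum, Nat.cast_pow, Nat.cast_ofNat, Real.log_pow, ← mul_assoc] at hentropy
  rw [mul_comm]
  refine (mul_le_mul_of_nonneg_right hweight T.cast_nonneg).trans ?_
  exact le_of_mul_le_mul_right hentropy (Real.log_pos one_lt_two)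

theorem load_nonneg (S : ShuffleScheme A E T) : 0 ≤ S.load := by
  unfold load
  positivity

end ShuffleScheme

theorem minLoad_nonneg (A : Allocation K n) (T : ℕ) (E : Set (Sym2 (Fin n))) :
    0 ≤ minLoad A T E :=
  Real.iInf_nonneg fun S => S.load_nonneg

theorem minLoad_le (S : ShuffleScheme A E T) : minLoad A T E ≤ S.load :=
  ciInf_le ⟨0, Set.forall_mem_range.2 fun S' => S'.load_nonneg⟩ S

theorem nonempty_shuffleScheme [NeZero K] (hM : ∀ j, ∃ k, j ∈ A.M k) :
    Nonempty (ShuffleScheme A E T) := by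
  obtain ⟨S, -⟩ := exists_codedShuffleScheme (A := A) (E := E) (T := T)
    (fun G => ∑ k, T * arcCount (A.R k ×ˢ A.batch (G.erase k)) E) fun k U hk => by
      rcases (A.batch U).eq_empty_or_nonempty with hU | ⟨j, hj⟩
      · simp [hU, arcCount]
      · have hj : A.mappers j = U := (Finset.mem_filter.1 hj).2
        have hcard : 0 < U.card := hj ▸ (Allocation.mappers_nonempty hM j).card_pos
        refine le_trans ?_ (Nat.le_mul_of_pos_left _ hcard)
        have := Finset.single_le_sum (f := fun l =>
          T * arcCount (A.R l ×ˢ A.batch ((insert k U).erase l)) E) (fun _ _ => Nat.zero_le _)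
          (Finset.mem_univ k)
        rwa [Finset.erase_insert hk] at this
  exact ⟨S⟩

theorem Allocation.sum_card_mappers (A : Allocation K n) :
    ∑ j, (A.mappers j).card = ∑ k, (A.M k).card := by
  simpa [Finset.bipartiteAbove, Finset.bipartiteBelow, Allocation.mappers] using
    Finset.sum_card_bipartiteAbove_eq_sum_card_bipartiteBelow
      (s := (Finset.univ : Finset (Fin n))) (t := (Finset.univ : Finset (Fin K)))
      (fun j k => j ∈ A.M k)

variable {r : ℕ}

theorem sum_missing_eq [NeZero K] (hA : A ∈ allocations K n r) (f : Fin n → ℝ) :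
    ∑ a ∈ A.missing, f a.2 = ∑ j, (K - (A.mappers j).card) * (n / K) * f j := by
  obtain ⟨-, -, -, hdisj, hcard⟩ := hA
  have hK : (K : ℝ) ≠ 0 := NeZero.ne _
  have hcardR : ∀ k, ((A.R k).card : ℝ) = n / K := fun k => by
    rw [eq_div_iff hK, mul_comm]
    exact_mod_cast hcard k
  rw [Finset.sum_finset_product_right A.missing Finset.univ
    (fun j => (A.mappers j)ᶜ.biUnion A.R) (fun a => by
      simp [Allocation.mem_missing, Allocation.mem_mappers, and_comm])]
  refine Finset.sum_congr rfl fun j _ => ?_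
  dsimp only
  rw [Finset.sum_const, nsmul_eq_mul, Finset.card_biUnion fun k _ l _ hkl => hdisj k l hkl,
    Nat.cast_sum, Finset.sum_congr rfl fun k _ => hcardR k, Finset.sum_const, nsmul_eq_mul,
    Finset.card_compl, Fintype.card_fin, Nat.cast_sub (card_finset_fin_le _)]

theorem sq_mul_le_sum_missing [NeZero K] (hA : A ∈ allocations K n r) :
    (n : ℝ) ^ 2 * (1 / r - 1 / K) ≤ ∑ a ∈ A.missing, 1 / ((A.mappers a.2).card : ℝ) := by
  have hK : (K : ℝ) ≠ 0 := NeZero.ne _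
  have hpos : ∀ j, (0 : ℝ) < (A.mappers j).card := fun j =>
    Nat.cast_pos.2 (Allocation.mappers_nonempty hA.1 j).card_pos
  have hload : ∑ j, ((A.mappers j).card : ℝ) = r * n := by
    exact_mod_cast A.sum_card_mappers.trans hA.2.1
  have hharmonic : (n : ℝ) ^ 2 / (r * n) ≤ ∑ j, 1 / ((A.mappers j).card : ℝ) := by
    simpa [hload] using Finset.sq_sum_div_le_sum_sq_div Finset.univ (fun _ => (1 : ℝ))
      (g := fun j => ((A.mappers j).card : ℝ)) fun j _ => hpos j
  calc (n : ℝ) ^ 2 * (1 / r - 1 / K) = n * (n ^ 2 / (r * n)) - n * (n / K) := by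
        rcases eq_or_ne (n : ℝ) 0 with hn | hn
        · simp [hn]
        · field_simp
    _ ≤ n * ∑ j, 1 / ((A.mappers j).card : ℝ) - n * (n / K) := by gcongr
    _ = ∑ j, (n * (1 / ((A.mappers j).card : ℝ)) - n / K) := by
        rw [Finset.sum_sub_distrib, Finset.mul_sum, Finset.sum_const, Finset.card_univ,
          Fintype.card_fin, nsmul_eq_mul]
    _ = ∑ j, (K - (A.mappers j).card) * (n / K) * (1 / ((A.mappers j).card : ℝ)) :=
        Finset.sum_congr rfl fun j _ => by
          have := (hpos j).ne'
          field_simp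
    _ = _ := (sum_missing_eq hA _).symm

-- Self-loops may be excluded, but then they cost at most `n` pairs of weight at most one.
theorem mul_sum_missing_sub_le_integral (A : Allocation K n) (loops : Prop) (p : unitInterval) :
    p * ∑ a ∈ A.missing, 1 / ((A.mappers a.2).card : ℝ) - n * p ≤
      ∫ E, ∑ a ∈ A.missing, E.indicator 1 s(a.1, a.2) / ((A.mappers a.2).card : ℝ)
        ∂erdosRenyi loops n p := by
  classical
  have hp : (0 : ℝ) ≤ p := p.2.1
  have hterm : ∀ a : Fin n × Fin n,
      p * (1 / ((A.mappers a.2).card : ℝ)) - (if a.1 = a.2 then (p : ℝ) else 0) ≤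
        (potentialEdges loops n).indicator (fun _ => (p : ℝ)) s(a.1, a.2) /
          ((A.mappers a.2).card : ℝ) := fun a => by
    split_ifs with h
    · refine (sub_nonpos.2 (mul_le_of_le_one_right hp ?_)).trans
        (div_nonneg (Set.indicator_nonneg (fun _ _ => hp) _) (Nat.cast_nonneg _))
      simpa only [one_div] using Nat.cast_inv_le_one _
    · have hmem : s(a.1, a.2) ∈ potentialEdges loops n := .inr (by simpa using h)
      rw [Set.indicator_of_mem hmem, sub_zero, mul_one_div]
  have hdiag : ∑ a ∈ A.missing, (if a.1 = a.2 then (p : ℝ) else 0) ≤ n * p := calc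
    _ ≤ ∑ a : Fin n × Fin n, if a.1 = a.2 then (p : ℝ) else 0 :=
        Finset.sum_le_sum_of_subset_of_nonneg (Finset.subset_univ _) fun _ _ _ => by
          split_ifs <;> positivity
    _ = n * p := by simp [Fintype.sum_prod_type]
  rw [erdosRenyi, integral_finsetSum _ fun a _ =>
    ((memLp_indicator_setBernoulli _ p s(a.1, a.2)).integrable one_le_two).div_const _]
  simp only [integral_div, integral_indicator_setBernoulli]
  refine le_trans ?_ (Finset.sum_le_sum fun a _ => hterm a)
  rw [Finset.sum_sub_distrib, ← Finset.mul_sum]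
  gcongr

theorem mul_le_integral_minLoad [NeZero K] (hn : n ≠ 0) (hT : T ≠ 0) (loops : Prop)
    (p : unitInterval) (hA : A ∈ allocations K n r) :
    (p : ℝ) * (1 / r - 1 / K - 1 / n) ≤ ∫ E, minLoad A T E ∂erdosRenyi loops n p := by
  have : (0 : ℝ) < n := by positivity
  have hT : (0 : ℝ) < T := by positivity
  have hload : ∀ E, (∑ a ∈ A.missing, E.indicator 1 s(a.1, a.2) / ((A.mappers a.2).card : ℝ)) /
      (n : ℝ) ^ 2 ≤ minLoad A T E := fun E => by
    have := nonempty_shuffleScheme (E := E) (T := T) hA.1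
    refine le_ciInf fun S => ?_
    rw [ShuffleScheme.load, mul_comm, ← div_div]
    gcongr
    rw [le_div_iff₀' hT]
    exact S.mul_sum_missing_le hA.1 hA.2.2.1
  calc (p : ℝ) * (1 / r - 1 / K - 1 / n)
      = (p * (n ^ 2 * (1 / r - 1 / K)) - n * p) / (n : ℝ) ^ 2 := by field_simp
    _ ≤ (p * ∑ a ∈ A.missing, 1 / ((A.mappers a.2).card : ℝ) - n * p) / (n : ℝ) ^ 2 := by
        have := p.2.1
        gcongr
        exact sq_mul_le_sum_missing hA
    _ ≤ (∫ E, ∑ a ∈ A.missing, E.indicator 1 s(a.1, a.2) / ((A.mappers a.2).card : ℝ)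
          ∂erdosRenyi loops n p) / (n : ℝ) ^ 2 := by
        gcongr
        exact mul_sum_missing_sub_le_integral A loops p
    _ ≤ ∫ E, minLoad A T E ∂erdosRenyi loops n p := by
        rw [← integral_div]
        exact integral_mono .of_finite .of_finite hload

end LowerBound

section BalancedAllocation

theorem exists_equidistributed {γ : Type*} [DecidableEq γ] {s : Finset γ} (hs : s.Nonempty)
    (m : ℕ) :
    ∃ h : Fin m → γ, (∀ b, h b ∈ s) ∧ ∀ c, Finset.card {b | h b = c} ≤ m / s.card + 1 := by
  have hpos := hs.card_pos
  refine ⟨fun b => s.equivFin.symm ⟨b % s.card, Nat.mod_lt _ hpos⟩, fun b => Subtype.prop _,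
    fun c => ?_⟩
  by_cases hc : c ∈ s
  · set i := s.equivFin ⟨c, hc⟩
    calc _ ≤ (Finset.range m |>.filter (· ≡ i [MOD s.card])).card := by
          refine Finset.card_le_card_of_injOn Fin.val (fun b hb => ?_) Fin.val_injective.injOn
          have hb : s.equivFin.symm ⟨b % s.card, Nat.mod_lt _ hpos⟩ = ⟨c, hc⟩ :=
            Subtype.ext (Finset.mem_filter.1 hb).2
          have hmod : b % s.card = i := congrArg Fin.val ((Equiv.symm_apply_eq _).1 hb)
          simp [Nat.ModEq, hmod, Nat.mod_eq_of_lt i.2]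
      _ ≤ m / s.card + 1 := by
          rw [← Nat.count_eq_card_filter_range, Nat.count_modEq_card _ hpos]
          split_ifs <;> lia
  · refine (Finset.card_eq_zero.2 (Finset.filter_eq_empty_iff.2 fun b _ hb => hc ?_)).trans_le
      (Nat.zero_le _)
    exact hb ▸ Subtype.prop _

variable {K r : ℕ} [NeZero K]

-- Translating every chosen `r`-set by all of `Fin K` makes the number of vertices per machine
-- exactly constant, while the `r`-sets themselves are used almost equally often.
theorem exists_balanced_batches (hrK : r ≤ K) (m : ℕ) :
    ∃ U : Fin K × Fin m → Finset (Fin K), (∀ x, (U x).card = r) ∧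
      (∀ k, Finset.card {x | k ∈ U x} = r * m) ∧
      ∀ B, (Finset.card {x | U x = B} : ℝ) ≤ (K * m : ℕ) / K.choose r + K := by
  obtain ⟨h, hcard, hfibre⟩ := exists_equidistributed
    (Finset.powersetCard_nonempty.2 (hrK.trans_eq (Finset.card_fin K).symm)) m
  simp only [Finset.mem_powersetCard_univ, Finset.card_powersetCard, Finset.card_fin]
    at hcard hfibre
  refine ⟨fun x => {k | k - x.1 ∈ h x.2}, fun x => ?_, fun k => ?_, fun B => ?_⟩
  · rw [← hcard x.2]
    exact Finset.card_equiv (Equiv.subRight x.1) (by simp)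
  · have hrow : ∀ b, Finset.card {a | k - a ∈ h b} = r := fun b => by
      rw [← hcard b]
      exact Finset.card_equiv (Equiv.subLeft k) (by simp)
    simp only [Finset.mem_filter, Finset.mem_univ, true_and, Finset.card_filter,
      Fintype.sum_prod_type_right]
    simp only [← Finset.card_filter, hrow, Finset.sum_const, Finset.card_fin, smul_eq_mul, mul_comm]
  · simp only [Finset.card_filter, Fintype.sum_prod_type]
    simp only [← Finset.card_filter]
    have hcolumn : ∀ a, Finset.card {b | ({k | k - a ∈ h b} : Finset (Fin K)) = B} ≤
        m / K.choose r + 1 := fun a => by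
      refine (Finset.card_le_card fun b hb => ?_).trans (hfibre {c | c + a ∈ B})
      refine Finset.mem_filter.2 ⟨Finset.mem_univ b, ?_⟩
      rw [← (Finset.mem_filter.1 hb).2]
      ext c
      simp
    calc _ ≤ ((∑ _a : Fin K, (m / K.choose r + 1) : ℕ) : ℝ) := by
          gcongr with a
          exact hcolumn a
      _ = K * ((m / K.choose r : ℕ) + 1) := by
          rw [Finset.sum_const, Finset.card_fin, smul_eq_mul, Nat.cast_mul, Nat.cast_succ]
      _ ≤ K * (m / K.choose r + 1) := by
          gcongr
          exact Nat.cast_div_le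
      _ = _ := by
          rw [mul_add, mul_one, ← mul_div_assoc, Nat.cast_mul]

theorem exists_balancedAllocation {n : ℕ} (hr : r ≠ 0) (hrK : r ≤ K) (hn : K ∣ n) :
    ∃ A ∈ balancedAllocations K n r, (∀ j, (A.mappers j).card = r) ∧
      ∀ B, ((A.batch B).card : ℝ) ≤ n / K.choose r + K := by
  obtain ⟨m, rfl⟩ := hn
  obtain ⟨U, hcard, hmachine, hbatch⟩ := exists_balanced_batches hrK m
  let machine (i : Fin (K * m)) : Fin K := (finProdFinEquiv.symm i).1
  let A : Allocation K (K * m) :=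
    ⟨fun k => {j | k ∈ U (finProdFinEquiv.symm j)}, fun k => {i | machine i = k}⟩
  have hmappers : ∀ j, A.mappers j = U (finProdFinEquiv.symm j) := fun j => by
    ext k
    simp [A, Allocation.mem_mappers]
  have hM : ∀ k, (A.M k).card = r * m := fun k => by
    rw [← hmachine k]
    exact Finset.card_equiv finProdFinEquiv.symm (by simp [A])
  have hR : ∀ k, (A.R k).card = m := fun k => calc
    (A.R k).card = ({k} ×ˢ (Finset.univ : Finset (Fin m))).card :=
      Finset.card_equiv finProdFinEquiv.symm fun i => by
        rw [Finset.mem_product, Finset.mem_singleton]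
        simp [A, machine]
    _ = m := by simp
  refine ⟨A, ⟨⟨fun j => ?_, ?_, fun i => ⟨machine i, by simp [A]⟩, fun k l hkl => ?_, fun k => ?_⟩,
    fun k => ?_⟩, fun j => hmappers j ▸ hcard _, fun B => ?_⟩
  · obtain ⟨k, hk⟩ := Finset.card_ne_zero.1 ((hmappers j ▸ hcard _).trans_ne hr)
    exact ⟨k, Allocation.mem_mappers.1 hk⟩
  · simp only [hM, Finset.sum_const, Finset.card_fin, smul_eq_mul]
    ring
  · exact Finset.disjoint_filter.2 fun i _ hk hl => hkl (hk.symm.trans hl)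
  · rw [hR]
  · rw [hM]
    ring
  · rw [Finset.card_equiv (s := A.batch B) (t := {x | U x = B}) finProdFinEquiv.symm fun j => by
      simp [Allocation.batch, hmappers]]
    exact hbatch B

end BalancedAllocation

section UpperBound

variable {K n r T : ℕ} {A : Allocation K n}

/-- The largest number of intermediate values that a machine `k` needs and that are known to exactly
the machines of the group `S` other than `k`. It determines the number of coded bits sent to `S`.
The maximum also runs over `k ∉ S`, which does not affect the asymptotics. -/
noncomputable def groupDemand (A : Allocation K n) (S : Finset (Fin K)) (E : Set (Sym2 (Fin n))) :
    ℝ :=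
  ⨆ k, (arcCount (A.R k ×ˢ A.batch (S.erase k)) E : ℝ)

theorem groupDemand_nonneg (A : Allocation K n) (S : Finset (Fin K)) (E : Set (Sym2 (Fin n))) :
    0 ≤ groupDemand A S E :=
  Real.iSup_nonneg fun _ => Nat.cast_nonneg _

theorem arcCount_le_groupDemand {k : Fin K} {U : Finset (Fin K)} (hk : k ∉ U)
    (E : Set (Sym2 (Fin n))) :
    (arcCount (A.R k ×ˢ A.batch U) E : ℝ) ≤ groupDemand A (insert k U) E := by
  have h := Finite.le_ciSup
    (fun l => (arcCount (A.R l ×ˢ A.batch ((insert k U).erase l)) E : ℝ)) k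
  rwa [Finset.erase_insert hk] at h

variable [NeZero K]

theorem exists_shuffleScheme_sum_eq_ceil (hr : r ≠ 0) (hcard : ∀ j, (A.mappers j).card = r)
    (E : Set (Sym2 (Fin n))) (T : ℕ) :
    ∃ S : ShuffleScheme A E T, ∑ k, S.c k =
      ∑ G ∈ Finset.powersetCard (r + 1) Finset.univ, (r + 1) * ⌈T * groupDemand A G E / r⌉₊ := by
  obtain ⟨S, hS⟩ := exists_codedShuffleScheme (A := A) (E := E) (T := T)
    (fun G => if G.card = r + 1 then ⌈T * groupDemand A G E / r⌉₊ else 0) fun k U hk => by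
      by_cases hU : U.card = r
      · rw [if_pos (by rw [Finset.card_insert_of_notMem hk, hU]), hU]
        suffices h : (T * arcCount (A.R k ×ˢ A.batch U) E : ℝ) ≤
          r * ⌈T * groupDemand A (insert k U) E / r⌉₊ by exact_mod_cast h
        rw [← div_le_iff₀' (by positivity)]
        refine le_trans ?_ (Nat.le_ceil _)
        gcongr
        exact arcCount_le_groupDemand hk E
      · have hempty : A.batch U = ∅ :=
          Finset.filter_eq_empty_iff.2 fun j _ hj => hU (hj ▸ hcard j)
        simp [hempty, arcCount]
  refine ⟨S, hS.trans ?_⟩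
  rw [Finset.powersetCard_eq_filter, Finset.powerset_univ, Finset.sum_filter]
  refine Finset.sum_congr rfl fun G _ => ?_
  split_ifs with hG
  · rw [hG]
  · rw [mul_zero]

theorem minLoad_le_sum_groupDemand (hr : r ≠ 0) (hT : T ≠ 0)
    (hcard : ∀ j, (A.mappers j).card = r) (E : Set (Sym2 (Fin n))) :
    minLoad A T E ≤ (r + 1) / (n : ℝ) ^ 2 *
      ∑ G ∈ Finset.powersetCard (r + 1) Finset.univ, (groupDemand A G E / r + 1) := by
  obtain ⟨S, hS⟩ := exists_shuffleScheme_sum_eq_ceil hr hcard E T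
  have hT₁ : (1 : ℝ) ≤ T := Nat.one_le_cast.2 (Nat.one_le_iff_ne_zero.2 hT)
  have hceil : ∀ G, (⌈T * groupDemand A G E / r⌉₊ : ℝ) ≤ T * (groupDemand A G E / r + 1) :=
    fun G => by
      have := groupDemand_nonneg A G E
      refine (Nat.ceil_lt_add_one (by positivity)).le.trans ?_
      rw [mul_add, mul_one, mul_div_assoc]
      gcongr
  have hlength : ((∑ k, S.c k : ℕ) : ℝ) ≤ T * ((r + 1) *
      ∑ G ∈ Finset.powersetCard (r + 1) Finset.univ, (groupDemand A G E / r + 1)) := by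
    rw [hS, Nat.cast_sum, Finset.mul_sum, Finset.mul_sum]
    refine Finset.sum_le_sum fun G _ => ?_
    rw [Nat.cast_mul, Nat.cast_succ, mul_left_comm (T : ℝ)]
    exact mul_le_mul_of_nonneg_left (hceil G) (by positivity)
  refine (minLoad_le S).trans ?_
  rw [ShuffleScheme.load, div_mul_eq_mul_div, mul_comm ((n : ℝ) ^ 2), ← div_div]
  gcongr
  exact (div_le_iff₀' (by positivity)).2 hlength

theorem integral_groupDemand_le (hR : ∀ k, K * (A.R k).card = n) {b : ℝ}
    (hbatch : ∀ U, ((A.batch U).card : ℝ) ≤ b) (loops : Prop) (p : unitInterval)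
    (S : Finset (Fin K)) :
    ∫ E, groupDemand A S E ∂erdosRenyi loops n p ≤ p * (n / K * b) + K * (√(2 * p) * n) := by
  have hp : (0 : ℝ) ≤ p := p.2.1
  have hpairs : ∀ k, ((A.R k ×ˢ A.batch (S.erase k)).card : ℝ) ≤ n / K * b := fun k => by
    have hRk : ((A.R k).card : ℝ) = n / K := by
      rw [eq_div_iff (NeZero.ne _), mul_comm]
      exact_mod_cast hR k
    rw [Finset.card_product, Nat.cast_mul, hRk]
    gcongr
    exact hbatch _
  have hsd : ∀ k, √(Var[fun E => (arcCount (A.R k ×ˢ A.batch (S.erase k)) E : ℝ);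
      erdosRenyi loops n p]) ≤ √(2 * p) * n := fun k => by
    refine Real.sqrt_le_iff.2 ⟨by positivity, (variance_arcCount_le loops p _).trans ?_⟩
    rw [mul_pow, Real.sq_sqrt (by positivity)]
    gcongr
    have h := Finset.card_le_univ (A.R k ×ˢ A.batch (S.erase k))
    rw [Fintype.card_prod, Fintype.card_fin, ← sq] at h
    exact_mod_cast h
  refine (integral_iSup_le_add_sum_sqrt_variance (fun k => memLp_arcCount loops p _)
    fun k => (integral_arcCount_le loops p _).trans
      (mul_le_mul_of_nonneg_left (hpairs k) hp)).trans ?_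
  gcongr
  refine (Finset.sum_le_sum fun k _ => hsd k).trans_eq ?_
  rw [Finset.sum_const, Finset.card_fin, nsmul_eq_mul]

theorem integral_minLoad_le (hr : r ≠ 0) (hT : T ≠ 0) (hR : ∀ k, K * (A.R k).card = n)
    (hcard : ∀ j, (A.mappers j).card = r) {b : ℝ} (hbatch : ∀ U, ((A.batch U).card : ℝ) ≤ b)
    (loops : Prop) (p : unitInterval) :
    ∫ E, minLoad A T E ∂erdosRenyi loops n p ≤ (r + 1) / (n : ℝ) ^ 2 *
      (K.choose (r + 1) * ((p * (n / K * b) + K * (√(2 * p) * n)) / r + 1)) := by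
  refine (integral_mono .of_finite .of_finite (minLoad_le_sum_groupDemand hr hT hcard)).trans ?_
  rw [integral_const_mul, integral_finsetSum _ fun _ _ => .of_finite]
  gcongr
  calc _ ≤ ∑ _S ∈ Finset.powersetCard (r + 1) (Finset.univ : Finset (Fin K)),
        (((p : ℝ) * (n / K * b) + K * (√(2 * p) * n)) / r + 1) := by
        gcongr with S
        rw [integral_add .of_finite .of_finite, integral_div, integral_const, probReal_univ,
          one_smul]
        gcongr
        exact integral_groupDemand_le hR hbatch loops p S
    _ = _ := by
        rw [Finset.sum_const, Finset.card_powersetCard, Finset.card_fin, nsmul_eq_mul]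

end UpperBound

section Limit

variable {K n r T : ℕ} {𝒜 : Set (Allocation K n)}

theorem minAvgLoad_le (T : ℕ) (loops : Prop) (p : unitInterval) {A : Allocation K n}
    (hA : A ∈ 𝒜) : minAvgLoad 𝒜 T loops p ≤ ∫ E, minLoad A T E ∂erdosRenyi loops n p :=
  ciInf_le (f := fun A : 𝒜 => ∫ E, minLoad A.1 T E ∂erdosRenyi loops n p)
    ⟨0, Set.forall_mem_range.2 fun A => integral_nonneg (minLoad_nonneg A.1 T)⟩ ⟨A, hA⟩

variable [NeZero K] {p : unitInterval}

theorem le_minAvgLoad_div (hr : r ≠ 0) (hrK : r ≤ K) (hn : n ≠ 0) (hKn : K ∣ n) (hT : T ≠ 0)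
    (loops : Prop) (hp : 0 < p) (hbal : balancedAllocations K n r ⊆ 𝒜)
    (hall : 𝒜 ⊆ allocations K n r) :
    1 / (r : ℝ) - 1 / K - 1 / n ≤ minAvgLoad 𝒜 T loops p / p := by
  obtain ⟨A, hA, -⟩ := exists_balancedAllocation hr hrK hKn
  have : Nonempty 𝒜 := ⟨⟨A, hbal hA⟩⟩
  rw [le_div_iff₀' hp]
  exact le_ciInf fun B => mul_le_integral_minLoad hn hT loops p (hall B.2)

theorem minAvgLoad_div_le (hr : r ≠ 0) (hrK : r ≤ K) (hn : n ≠ 0) (hKn : K ∣ n) (hT : T ≠ 0)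
    (loops : Prop) (hp : 0 < p) (hbal : balancedAllocations K n r ⊆ 𝒜) :
    minAvgLoad 𝒜 T loops p / p ≤ 1 / (r : ℝ) - 1 / K + K.choose r * (K - r) / r *
      (1 / n + K * √(2 * (1 / (n : ℝ) ^ 2 / p)) + r * (1 / (n : ℝ) ^ 2 / p)) := by
  have hp : (0 : ℝ) < p := hp
  obtain ⟨A, hA, hcard, hbatch⟩ := exists_balancedAllocation hr hrK hKn
  have hchoose : (K.choose (r + 1) : ℝ) * (r + 1) = K.choose r * (K - r) := by
    rw [← Nat.cast_sub hrK]
    exact_mod_cast Nat.choose_succ_right_eq K r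
  have hsqrt : √(2 * (1 / (n : ℝ) ^ 2 / p)) = √(2 * p) / (n * p) := by
    rw [← Real.sqrt_sq (by positivity : 0 ≤ n * (p : ℝ)), ← Real.sqrt_div (by positivity)]
    congr 1
    field_simp
  have hC : (0 : ℝ) < K.choose r := Nat.cast_pos.2 (Nat.choose_pos hrK)
  have hK : (K : ℝ) ≠ 0 := NeZero.ne _
  rw [div_le_iff₀ hp, hsqrt]
  calc minAvgLoad 𝒜 T loops p
      ≤ (r + 1) / (n : ℝ) ^ 2 * (K.choose (r + 1) *
          ((p * (n / K * (n / K.choose r + K)) + K * (√(2 * p) * n)) / r + 1)) :=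
        (minAvgLoad_le T loops p (hbal hA)).trans
          (integral_minLoad_le hr hT hA.1.2.2.2.2 hcard hbatch loops p)
    _ = K.choose (r + 1) * (r + 1) / (n : ℝ) ^ 2 *
          ((p * (n / K * (n / K.choose r + K)) + K * (√(2 * p) * n)) / r + 1) := by ring
    _ = _ := by
        rw [hchoose]
        field_simp
        ring

end Limit

theorem theorem1_general {K r : ℕ} (hr : r ≠ 0) (hrK : r ≤ K)
    {𝒜 : ∀ n, Set (Allocation K n)} (hbal : ∀ n, balancedAllocations K n r ⊆ 𝒜 n)
    (hall : ∀ n, 𝒜 n ⊆ allocations K n r) {T : ℕ → ℕ} (hT : ∀ n, T n ≠ 0) (loops : Prop)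
    {p : ℕ → unitInterval}
    (hp : (fun n : ℕ => 1 / (n : ℝ) ^ 2) =o[atTop ⊓ 𝓟 {n : ℕ | K ∣ n}] fun n => (p n : ℝ)) :
    Tendsto (fun n => minAvgLoad (𝒜 n) (T n) loops (p n) / (p n : ℝ))
      (atTop ⊓ 𝓟 {n : ℕ | K ∣ n}) (𝓝 (1 / (r : ℝ) * (1 - (r : ℝ) / (K : ℝ)))) := by
  have : NeZero K := ⟨(Nat.pos_of_ne_zero hr |>.trans_le hrK).ne'⟩
  have hvalue : 1 / (r : ℝ) * (1 - r / K) = 1 / r - 1 / K := by field_simp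
  have hn : Tendsto (fun n : ℕ => 1 / (n : ℝ)) (atTop ⊓ 𝓟 {n | K ∣ n}) (𝓝 0) :=
    tendsto_one_div_atTop_nhds_zero_nat.mono_left inf_le_left
  have hnp := hp.tendsto_div_nhds_zero
  have hsqrt := (hnp.const_mul 2).sqrt.const_mul (K : ℝ)
  have hlower : Tendsto (fun n : ℕ => 1 / (r : ℝ) - 1 / K - 1 / n) (atTop ⊓ 𝓟 {n | K ∣ n})
      (𝓝 (1 / r * (1 - r / K))) := by
    simpa only [hvalue, sub_zero] using hn.const_sub (1 / (r : ℝ) - 1 / K)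
  have hupper := (((hn.add hsqrt).add (hnp.const_mul (r : ℝ))).const_mul
    (K.choose r * (K - r) / r : ℝ)).const_add (1 / (r : ℝ) - 1 / K)
  simp only [mul_zero, Real.sqrt_zero, add_zero, ← hvalue] at hupper
  have hgood : ∀ᶠ n in atTop ⊓ 𝓟 {n | K ∣ n}, n ≠ 0 ∧ K ∣ n ∧ 0 < p n := by
    filter_upwards [(eventually_ne_atTop 0).filter_mono inf_le_left,
      mem_inf_of_right (mem_principal_self _), hp.bound one_pos] with n hn hKn hbound
    refine ⟨hn, hKn, lt_of_le_of_ne (p n).2.1 fun h0 => ?_⟩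
    simp [← h0, hn] at hbound
  refine tendsto_of_tendsto_of_tendsto_of_le_of_le' hlower hupper ?_ ?_
  · filter_upwards [hgood] with n ⟨hn, hKn, hpn⟩
    exact le_minAvgLoad_div hr hrK hn hKn (hT n) loops hpn (hbal n) (hall n)
  · filter_upwards [hgood] with n ⟨hn, hKn, hpn⟩
    simpa only [hvalue] using minAvgLoad_div_le hr hrK hn hKn (hT n) loops hpn (hbal n)

theorem theorem1 (K r : ℕ) (hr : 1 ≤ r) (hrK : r ≤ K)
    (T : ℕ → ℕ) (hT : ∀ n, 1 ≤ T n)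
    (loops : Prop)
    (p : ℕ → unitInterval) (hp_pos : ∀ n, 0 < p n)
    (hp : (fun n : ℕ => 1 / (n : ℝ) ^ 2) =o[atTop ⊓ 𝓟 {n : ℕ | K ∣ n}]
      (fun n : ℕ => (p n : ℝ))) :
    Tendsto (fun n : ℕ =>
        minAvgLoad (balancedAllocations K n r) (T n) loops (p n) / (p n : ℝ))
      (atTop ⊓ 𝓟 {n : ℕ | K ∣ n})
      (𝓝 (1 / (r : ℝ) * (1 - (r : ℝ) / (K : ℝ)))) ∧
    Tendsto (fun n : ℕ =>
        minAvgLoad (allocations K n r) (T n) loops (p n) / (p n : ℝ))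
      (atTop ⊓ 𝓟 {n : ℕ | K ∣ n})
      (𝓝 (1 / (r : ℝ) * (1 - (r : ℝ) / (K : ℝ)))) := by
  have h {𝒜 : ∀ n, Set (Allocation K n)} hbal hall := theorem1_general (𝒜 := 𝒜)
    (Nat.one_le_iff_ne_zero.1 hr) hrK hbal hall (fun n => Nat.one_le_iff_ne_zero.1 (hT n)) loops hp
  exact ⟨h (fun _ => subset_rfl) fun _ _ hA => hA.1, h (fun _ _ hA => hA.1) fun _ => subset_rfl⟩
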